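/- **RDP for Poisson subsampling.** Let $\mathcal X$ be a set; a dataset is a finite subset of $\mathcal X$, and two datasets $D,D'$ are adjacent if $D'=D\cup\{a\}$ or $D'=D\setminus\{a\}$ for some $a\in\mathcal X$. Let $f$ map datasets to $\mathbb R^d$ with $\ell_2$-sensitivity $\sup_{D,D'\text{ adjacent}}\|f(D)-f(D')\|_2\le 1$. Let $\nu\in\mathbb R$, $0<\tau\le 1$, and let $\mathcal M_\tau$ be the Gaussian mechanism under Poisson subsampling at rate $\tau$: given a dataset $D$, it forms a random subset $S\subseteq D$ containing each point of $D$ independently with probability $\tau$, and outputs $f(S)+\mathbf n$, where $\mathbf n\sim\mathcal N(0,\nu^2 I_d)$ is independent of $S$. Let $\alpha>1$ be real and suppose that $$\nu^2\ge\frac59\qquad\text{and}\qquad \alpha-1\le\frac23\,\nu^2\log\frac{1}{\alpha\tau(1+\nu^2)} .$$ Then $\mathcal M_\tau$ is $(\alpha,\,2\tau^2\alpha/\nu^2)$-RDP, i.e. for all adjacent datasets $D,D'$, $$D_\alpha\big(\mathcal M_\tau(D)\,\|\,\mathcal M_\tau(D')\big)=\frac{1}{\alpha-1}\log \mathbb E_{\omega\sim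 \mathcal M_\tau(D')}\left[\left(\frac{d\mathcal M_\tau(D)}{d\mathcal M_\tau(D')}(\omega)\right)^{\alpha}\right]\le\frac{2\tau^2\alpha}{\nu^2},$$ where $\mathcal M_\tau(D)$ also denotes the law of the output on $D$ (and $D_\alpha=+\infty$ when that law is not absolutely continuous with respect to the other). -/

import Mathlib

open MeasureTheory ProbabilityTheory
open scoped ENNReal

namespace SubsampledRDP

/-- Two datasets (finite sets of data points) are adjacent if one is obtained from the other by
adding or removing a single data point. -/
def Adjacent {X : Type*} [DecidableEq X] (D D' : Finset X) : Prop :=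
  ∃ a : X, D' = insert a D ∨ D' = D.erase a

/-- The `ℓ²`-sensitivity of a query: the supremum of `‖f D - f D'‖₂` over all adjacent datasets,
as an extended nonnegative real. -/
noncomputable def l2Sensitivity {X : Type*} [DecidableEq X] {d : ℕ}
    (f : Finset X → EuclideanSpace ℝ (Fin d)) : ℝ≥0∞ :=
  ⨆ (D : Finset X) (D' : Finset X) (_ : Adjacent D D'), ENNReal.ofReal ‖f D - f D'‖

/-- A randomized mechanism with values in `ℝᵈ`, given by the law of its output on each dataset. -/
abbrev Mechanism (X : Type*) (d : ℕ) : Type _ :=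
  Finset X → Measure (EuclideanSpace ℝ (Fin d))

/-- The Gaussian mechanism `D ↦ f D + 𝒩(0, ν² I)`. -/
noncomputable def gaussianMechanism {X : Type*} {d : ℕ}
    (f : Finset X → EuclideanSpace ℝ (Fin d)) (ν : ℝ) : Mechanism X d :=
  fun D => multivariateGaussian (f D) (ν ^ 2 • (1 : Matrix (Fin d) (Fin d) ℝ))

/-- The probability that the Poisson subsample of `D` with rate `τ`, which contains each point of
`D` independently with probability `τ`, is equal to the subset `S` of `D`. -/
noncomputable def poissonWeight {X : Type*} [DecidableEq X] (τ : ℝ) (D S : Finset X) : ℝ :=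
  ∏ x ∈ D, if x ∈ S then τ else 1 - τ

/-- The Poisson-subsampled version of a mechanism `M`: the law of `M S` where `S` is a Poisson
subsample of the dataset with rate `τ`, drawn independently of the randomness of `M`. -/
noncomputable def poissonSubsampled {X : Type*} [DecidableEq X] {d : ℕ} (τ : ℝ)
    (M : Mechanism X d) : Mechanism X d :=
  fun D => ∑ S ∈ D.powerset, ENNReal.ofReal (poissonWeight τ D S) • M S

/-- The Rényi divergence `D_α(P ‖ Q) = (α - 1)⁻¹ log 𝔼_Q[(dP/dQ)^α]` of order `α > 1`, with values
in the extended reals; it is `+∞` if `P` is not absolutely continuous with respect to `Q`. -/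
noncomputable def renyiDiv {Ω : Type*} [MeasurableSpace Ω] (α : ℝ) (P Q : Measure Ω) : EReal :=
  open Classical in
  if P ≪ Q then ((1 / (α - 1) : ℝ) : EReal) * ENNReal.log (∫⁻ ω, (P.rnDeriv Q ω) ^ α ∂Q) else ⊤

/-- `(α, ρ)`-Rényi differential privacy with respect to add/remove adjacency, for `α > 1`. -/
def IsRDP {X : Type*} [DecidableEq X] {d : ℕ} (M : Mechanism X d) (α ρ : ℝ) : Prop :=
  ∀ D D' : Finset X, Adjacent D D' → renyiDiv α (M D) (M D') ≤ (ρ : EReal)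

end SubsampledRDP

/-! If `a ∉ D`, subsampling `insert a D` means subsampling `S ⊆ D` and then adding `a` with
probability `τ`. Both output laws are thus mixtures over the same `S` with the same weights, and
joint convexity of `(p, q) ↦ (p / q) ^ α * q` (`renyi_moment_mixture_le`) reduces the claim to one
`S`: compare `𝒩(v, ν² I)` with `(1 - τ) 𝒩(v, ν² I) + τ 𝒩(w, ν² I)`, in both orders, where `‖v - w‖ ≤
1`.

With `r` the likelihood ratio of `w` to `v`, the two moments are the expectations under `𝒩(v, ν² I)`
of `(1 - τ + τ r) ^ α` and `(1 - τ + τ r) ^ (1 - α)`. In a second-order expansion around `r = 1` the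
linear term has mean zero, and the quadratic one is `α (α - 1) / 2 * τ²` times `(r - 1)²`, of mean
at most `exp x - 1 ≤ 2.9 x`, where `x = 1 / ν² ≤ 9 / 5`. A total of `4 x` in place of `2.9 x` is
affordable: it gives a moment of at most `1 + 2 α (α - 1) τ² x`, and `log (1 + y) ≤ y` concludes.
`DominatedByMoments` records this budget.

The remainder must fit in the slack. Only `(1 - τ + τ r) ^ α` with `α > 2` and large `r` is
delicate: it costs a higher moment `exp (m (m - 1) / 2 * x)`, which is paid for by the smallness of
`τ`, in the form `α τ (1 + x) ≤ x exp (-(3 / 2) (α - 1) x)`. -/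

namespace SubsampledRDP

/-! ### Second-order upper bounds for real powers near 1. -/

section RealAnalysis

/-- A function whose derivative is at most `s + 2 k t` on `[0, b]` grows at most like
`s b + k b²`. -/
lemma le_quadratic_of_deriv_le {f f' : ℝ → ℝ} {b s k : ℝ} (hb : 0 ≤ b)
    (hf : ∀ t ∈ Set.Icc 0 b, HasDerivAt f (f' t) t)
    (h : ∀ t ∈ Set.Icc 0 b, f' t ≤ s + 2 * k * t) :
    f b ≤ f 0 + s * b + k * b ^ 2 := by
  have hd : ∀ t ∈ Set.Icc 0 b,
      HasDerivAt (fun t => s * t + k * t ^ 2 - f t) (s + 2 * k * t - f' t) t := by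
    intro t ht
    have h1 : HasDerivAt (fun t => s * t + k * t ^ 2) (s * 1 + k * (2 * t)) t := by
      exact (((hasDerivAt_id t).const_mul s).add ((hasDerivAt_pow 2 t).const_mul k)).congr_deriv
        (by simp)
    exact (h1.sub (hf t ht)).congr_deriv (by ring)
  have hm : MonotoneOn (fun t => s * t + k * t ^ 2 - f t) (Set.Icc 0 b) := by
    refine monotoneOn_of_hasDerivWithinAt_nonneg (convex_Icc 0 b)
      (fun t ht => (hd t ht).continuousAt.continuousWithinAt)
      (f' := fun t => s + 2 * k * t - f' t)
      (fun t ht => (hd t (interior_subset ht)).hasDerivWithinAt) ?_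
    intro t ht
    have := h t (interior_subset ht)
    linarith
  have := hm (Set.left_mem_Icc.2 hb) (Set.right_mem_Icc.2 hb) hb
  simp only at this
  linarith

lemma one_sub_rpow_hasDerivAt {t : ℝ} (s : ℝ) (ht : t < 1) :
    HasDerivAt (fun t : ℝ => (1 - t) ^ s) (-(s * (1 - t) ^ (s - 1))) t := by
  have h := ((hasDerivAt_id t).const_sub 1).rpow_const (p := s) (Or.inl (by simp; linarith))
  exact h.congr_deriv (by simp)

lemma one_add_rpow_hasDerivAt {t : ℝ} (s : ℝ) (ht : 0 ≤ t) :
    HasDerivAt (fun t : ℝ => (1 + t) ^ s) (s * (1 + t) ^ (s - 1)) t := by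
  have h := ((hasDerivAt_id t).const_add 1).rpow_const (p := s)
    (Or.inl (by simp; linarith))
  exact h.congr_deriv (by simp)

/-- Bernoulli's inequality in the form `(1 - t)^s ≥ 1 - s t` for `s ≥ 1`. -/
lemma one_sub_mul_le_rpow {s t : ℝ} (hs : 1 ≤ s) (ht : t ≤ 1) : 1 - s * t ≤ (1 - t) ^ s := by
  have := one_add_mul_self_le_rpow_one_add (s := -t) (by linarith) hs
  rw [← sub_eq_add_neg] at this
  linarith

/-- Bernoulli's inequality in the form `(1 - t)^s ≤ 1 - s t` for `0 ≤ s ≤ 1`. -/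
lemma rpow_le_one_sub_mul {s t : ℝ} (hs0 : 0 ≤ s) (hs : s ≤ 1) (ht : t ≤ 1) :
    (1 - t) ^ s ≤ 1 - s * t := by
  have := rpow_one_add_le_one_add_mul_self (s := -t) (by linarith) hs0 hs
  rw [← sub_eq_add_neg] at this
  linarith

/-- Second-order bound for `(1 - v)^(1 - α)`. -/
lemma one_sub_rpow_one_sub_le {α v M : ℝ} (hα : 1 < α) (hv : 0 ≤ v) (hαv : α * v < 1)
    (hM : 1 ≤ M * (1 - α * v)) :
    (1 - v) ^ (1 - α) ≤ 1 + (α - 1) * v + α * (α - 1) / 2 * M * v ^ 2 := by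
  have hM0 : 0 ≤ M := by
    by_contra! hneg
    nlinarith
  have key : ∀ t ∈ Set.Icc 0 v, α * t < 1 ∧ t < 1 := fun t ht => by
    have : α * t < 1 := lt_of_le_of_lt (by gcongr; exact ht.2) hαv
    exact ⟨this, by nlinarith [ht.1]⟩
  have := le_quadratic_of_deriv_le (s := α - 1) (k := α * (α - 1) / 2 * M) hv
    (fun t ht => one_sub_rpow_hasDerivAt (1 - α) (key t ht).2) (fun t ht => ?_)
  · simpa using this
  obtain ⟨h1, h2⟩ := key t ht
  -- Bernoulli gives `(1 - t) ^ (-α) ≤ 1 / (1 - α t) = 1 + α t / (1 - α t)`, and `M` bounds `1 / (1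
  -- - α t)`.
  have h3 : (1 - t) ^ (1 - α - 1) ≤ 1 + α * M * t := by
    rw [show 1 - α - 1 = -α by ring, Real.rpow_neg (by linarith)]
    have h4 := one_sub_mul_le_rpow hα.le h2.le
    rw [inv_le_comm₀ (by apply Real.rpow_pos_of_pos; linarith)
      (by have := ht.1; positivity)]
    refine le_trans ?_ h4
    rw [inv_le_iff_one_le_mul₀ (by have := ht.1; positivity)]
    have h5 : 1 ≤ M * (1 - α * t) := hM.trans (by gcongr; exact ht.2)
    have h6 : 0 ≤ α * t := mul_nonneg (by linarith) ht.1
    nlinarith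
  nlinarith

/-- Second-order bound for `(1 + u)^(1 - α)`, `u ≥ 0`. -/
lemma one_add_rpow_one_sub_le {α u : ℝ} (hα : 1 < α) (hu : 0 ≤ u) :
    (1 + u) ^ (1 - α) ≤ 1 + (1 - α) * u + α * (α - 1) / 2 * u ^ 2 := by
  have := le_quadratic_of_deriv_le (s := 1 - α) (k := α * (α - 1) / 2) hu
    (fun t ht => one_add_rpow_hasDerivAt (1 - α) ht.1) (fun t ht => ?_)
  · simpa using this
  have h3 : 1 - α * t ≤ (1 + t) ^ (1 - α - 1) := by
    have h0 : 0 < 1 + t := by linarith [ht.1]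
    rw [Real.rpow_def_of_pos h0]
    have h1 := Real.add_one_le_exp (Real.log (1 + t) * (1 - α - 1))
    have h2 := Real.log_le_sub_one_of_pos h0
    nlinarith
  nlinarith

/-- Second-order bound for `(1 - v)^α`, `α ≥ 2`. -/
lemma one_sub_rpow_le_of_two_le {α v : ℝ} (hα : 2 ≤ α) (hv : 0 ≤ v) (hv1 : v < 1) :
    (1 - v) ^ α ≤ 1 - α * v + α * (α - 1) / 2 * v ^ 2 := by
  have := le_quadratic_of_deriv_le (s := -α) (k := α * (α - 1) / 2) hv
    (fun t ht => one_sub_rpow_hasDerivAt α (ht.2.trans_lt hv1)) (fun t ht => ?_)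
  · simpa [sub_eq_add_neg] using this
  have h3 := one_sub_mul_le_rpow (s := α - 1) (t := t) (by linarith) (by linarith [ht.2])
  nlinarith

/-- Second-order bound for `(1 - v)^α`, `1 < α ≤ 2`. -/
lemma one_sub_rpow_le_of_le_two {α v M : ℝ} (hα : 1 < α) (hα2 : α ≤ 2) (hv : 0 ≤ v) (hv1 : v < 1)
    (hM : 1 ≤ M * (1 - v)) :
    (1 - v) ^ α ≤ 1 - α * v + α * (α - 1) / 2 * M * v ^ 2 := by
  have hM0 : 0 ≤ M := by
    by_contra! hneg
    nlinarith
  have := le_quadratic_of_deriv_le (s := -α) (k := α * (α - 1) / 2 * M) hv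
    (fun t ht => one_sub_rpow_hasDerivAt α (ht.2.trans_lt hv1)) (fun t ht => ?_)
  · simpa [sub_eq_add_neg] using this
  have ht1 : 0 < 1 - t := by linarith [ht.2]
  -- Concave Bernoulli applied to the complementary power `2 - α`: `(1 - t) ^ (α - 1) ≥ (1 - t) / (1
  -- - (2 - α) t) = 1 - (α - 1) t / (1 - (2 - α) t)`.
  have h3 : 1 - (α - 1) * M * t ≤ (1 - t) ^ (α - 1) := by
    have h4 := rpow_le_one_sub_mul (s := 2 - α) (t := t) (by linarith) (by linarith) (by linarith)
    have h5 : (1 - t) ^ (α - 1) * (1 - t) ^ (2 - α) = 1 - t := by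
      rw [← Real.rpow_add ht1]; simp [show α - 1 + (2 - α) = 1 by ring]
    have h6 : 0 < (1 - t) ^ (α - 1) := Real.rpow_pos_of_pos ht1 _
    have h7 : 1 ≤ M * (1 - t) := hM.trans (by gcongr; exact ht.2)
    have h8 : 1 - t ≤ (1 - t) ^ (α - 1) * (1 - (2 - α) * t) := by
      calc 1 - t = (1 - t) ^ (α - 1) * (1 - t) ^ (2 - α) := h5.symm
        _ ≤ _ := by gcongr
    have h9 : 0 < 1 - (2 - α) * t := by nlinarith [ht.1]
    refine le_of_mul_le_mul_right (le_trans ?_ h8) h9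
    have h10 : 1 ≤ M * (1 - (2 - α) * t) := by
      refine h7.trans ?_
      gcongr
      nlinarith [ht.1]
    have h11 : 0 ≤ (α - 1) * t := mul_nonneg (by linarith) ht.1
    nlinarith
  nlinarith

/-- Second-order bound for `(1 + u)^α`, `1 < α ≤ 2`, `u ≥ 0`. -/
lemma one_add_rpow_le_of_le_two {α u : ℝ} (hα : 1 < α) (hα2 : α ≤ 2) (hu : 0 ≤ u) :
    (1 + u) ^ α ≤ 1 + α * u + α * (α - 1) / 2 * u ^ 2 := by
  have := le_quadratic_of_deriv_le (s := α) (k := α * (α - 1) / 2) hu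
    (fun t ht => one_add_rpow_hasDerivAt α ht.1) (fun t ht => ?_)
  · simpa using this
  have h3 := rpow_one_add_le_one_add_mul_self (s := t) (p := α - 1) (by linarith [ht.1])
    (by linarith) (by linarith)
  nlinarith

/-- Second-order bound for `(1 + u)^α`, `α ≥ 2`, `u ≥ 0`. -/
lemma one_add_rpow_le_of_two_le {α u : ℝ} (hα : 2 ≤ α) (hu : 0 ≤ u) :
    (1 + u) ^ α ≤ 1 + α * u + α * (α - 1) / 2 * (1 + u) ^ (α - 2) * u ^ 2 := by
  have := le_quadratic_of_deriv_le (s := α) (k := α * (α - 1) / 2 * (1 + u) ^ (α - 2)) hu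
    (fun t ht => one_add_rpow_hasDerivAt α ht.1) (fun t ht => ?_)
  · simpa using this
  have ht0 : 0 < 1 + t := by linarith [ht.1]
  -- Bernoulli at `1 / (1 + t) = 1 - t / (1 + t)`, multiplied through by `(1 + t) ^ (α - 1)`.
  have h1 : (1 + t) ^ (α - 1) ≤ 1 + (α - 1) * t * (1 + t) ^ (α - 2) := by
    have h2 := one_sub_mul_le_rpow (s := α - 1) (t := t / (1 + t)) (by linarith)
      (by rw [div_le_one ht0]; linarith)
    have h3 : 1 - t / (1 + t) = (1 + t)⁻¹ := by field_simp; simp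
    rw [h3, Real.inv_rpow ht0.le] at h2
    have h4 : 0 < (1 + t) ^ (α - 1) := Real.rpow_pos_of_pos ht0 _
    have h5 : (1 + t) ^ (α - 1) = (1 + t) ^ (α - 2) * (1 + t) := by
      conv_rhs => rw [← Real.rpow_add_one ht0.ne']
      congr 1; ring
    have h6 := mul_le_mul_of_nonneg_right h2 h4.le
    rw [inv_mul_cancel₀ h4.ne'] at h6
    have h7 : (1 - (α - 1) * (t / (1 + t))) * (1 + t) ^ (α - 1)
        = (1 + t) ^ (α - 1) - (α - 1) * t * (1 + t) ^ (α - 2) := by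
      rw [sub_mul, one_mul, h5]; field_simp
    linarith
  have h8 : (1 + t) ^ (α - 2) ≤ (1 + u) ^ (α - 2) :=
    Real.rpow_le_rpow ht0.le (by linarith [ht.2]) (by linarith)
  have h9 : 0 ≤ (α - 1) * t := mul_nonneg (by linarith) ht.1
  have h10 : (1 + t) ^ (α - 1) ≤ 1 + (α - 1) * t * (1 + u) ^ (α - 2) :=
    h1.trans (by gcongr)
  nlinarith

end RealAnalysis

/-! ### Domination of the two moment integrands within the budget `4 x`. -/

section LikelihoodRatioBounds

/-- The function `F` is dominated by a combination of `r`, `r²` and a power `r ^ m` whose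
expectation is at most `1 + 2 α (α - 1) τ² x`, whenever `r` is the likelihood ratio of two Gaussian
distributions with a squared signal-to-noise ratio at most `x`. -/
def DominatedByMoments (x τ α : ℝ) (F : ℝ → ℝ) : Prop :=
  ∃ s K B D m : ℝ, 0 ≤ K ∧ 0 ≤ B ∧ 1 ≤ m ∧
    K * (Real.exp x - 1) + B * Real.exp (m * (m - 1) / 2 * x) + D ≤ 4 * x ∧
    ∀ r, 0 < r → F r ≤ 1 + s * τ * (r - 1) +
      α * (α - 1) / 2 * τ ^ 2 * (K * (r - 1) ^ 2 + B * r ^ m + D)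

lemma exp_nine_fifths_le : Real.exp (9 / 5) ≤ 6.22 := by
  have h1 := Real.exp_one_lt_d9
  have h2 : Real.exp (9 / 5) = Real.exp 1 * Real.exp 1 * (Real.exp (1 / 5))⁻¹ := by
    rw [← Real.exp_add, ← Real.exp_neg, ← Real.exp_add]; norm_num
  have h3 := Real.add_one_le_exp (1 / 5 : ℝ)
  have h4 : (Real.exp (1 / 5))⁻¹ ≤ (6 / 5 : ℝ)⁻¹ := by
    apply inv_anti₀ <;> linarith
  have h5 : Real.exp 1 * Real.exp 1 ≤ 2.72 * 2.72 := by gcongr <;> linarith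
  rw [h2]
  calc _ ≤ 2.72 * 2.72 * (6 / 5 : ℝ)⁻¹ := by gcongr
    _ ≤ _ := by norm_num

/-- The chord of `exp` over `[0, 9/5]` lies above the graph; `6.22 = 1 + 2.9 * (9/5)`. -/
lemma exp_sub_one_le {x : ℝ} (hx : 0 ≤ x) (hx1 : x ≤ 9 / 5) : Real.exp x - 1 ≤ 2.9 * x := by
  obtain ⟨-, hc⟩ := convexOn_exp
  have h := hc (Set.mem_univ 0) (Set.mem_univ (9 / 5)) (show 0 ≤ 1 - 5 / 9 * x by linarith)
    (show 0 ≤ 5 / 9 * x by linarith) (by ring)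
  simp only [smul_eq_mul, mul_zero, zero_add, Real.exp_zero, mul_one] at h
  rw [show 5 / 9 * x * (9 / 5) = x by ring] at h
  nlinarith [exp_nine_fifths_le]

/-- Used with `p = α - 2` for `2 ≤ α ≤ 3`. At `x = 9/5` the exponent is `2.7 (1 - p)`, and `y * exp
(1 - y) ≤ 1` at `y = 2.7 p` gives the bound `exp 1.7 / 2.7`. -/
lemma mul_exp_le {x p : ℝ} (hx1 : x ≤ 9 / 5) (hp : 0 ≤ p) (hp1 : p ≤ 1) :
    p * Real.exp (3 / 2 * (1 - p) * x) ≤ 2.2 := by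
  have h1 : Real.exp (3 / 2 * (1 - p) * x) ≤ Real.exp (17 / 10) * Real.exp (-(2.7 * p - 1)) := by
    rw [← Real.exp_add, Real.exp_le_exp]; nlinarith
  have h2 := Real.add_one_le_exp (2.7 * p - 1)
  have h3 : Real.exp (17 / 10) ≤ 5.94 := by
    have h5 := exp_nine_fifths_le
    have h6 : Real.exp (9 / 5) = Real.exp (17 / 10) * Real.exp (1 / 10) := by
      rw [← Real.exp_add]; norm_num
    have h7 := Real.add_one_le_exp (1 / 10 : ℝ)
    nlinarith [Real.exp_pos (17 / 10)]
  have h4 : p * Real.exp (-(2.7 * p - 1)) ≤ 1 / 2.7 := by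
    rw [Real.exp_neg, mul_inv_le_iff₀ (Real.exp_pos _)]; linarith
  calc _ ≤ p * (Real.exp (17 / 10) * Real.exp (-(2.7 * p - 1))) := by gcongr
    _ = Real.exp (17 / 10) * (p * Real.exp (-(2.7 * p - 1))) := by ring
    _ ≤ 5.94 * (1 / 2.7) := by gcongr
    _ = 2.2 := by norm_num

variable {x τ α : ℝ}

lemma mul_rate_le (hx : 0 < x) (hα : 1 < α)
    (h : α * τ * (1 + x) ≤ x * Real.exp (-(3 / 2 * (α - 1) * x))) : α * τ * (1 + x) ≤ x := by
  refine h.trans (mul_le_of_le_one_right hx.le (Real.exp_le_one_iff.2 ?_))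
  have : 0 ≤ (α - 1) * x := mul_nonneg (by linarith) hx.le
  linarith

lemma dominatedByMoments_rpow_one_sub (hx : 0 < x) (hx1 : x ≤ 9 / 5) (hτ : 0 < τ) (hα : 1 < α)
    (h : α * τ * (1 + x) ≤ x * Real.exp (-(3 / 2 * (α - 1) * x))) :
    DominatedByMoments x τ α (fun r => (1 - τ + τ * r) ^ (1 - α)) := by
  have h0 := mul_rate_le hx hα h
  have hA : 0 < α * (α - 1) / 2 := by have : 0 < α - 1 := by linarith
                                      positivity
  -- As `B = 0`, the exponent `m = 1` is a dummy. For `r ≤ 1` the expansion loses a factor `M = 1 +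
  -- x`, since `α τ ≤ x / (1 + x)`; the excess `x (r - 1)² ≤ x` is charged to `D = x`.
  refine ⟨1 - α, 1, 0, x, 1, by norm_num, le_rfl, le_rfl, ?_, fun r hr => ?_⟩
  · linarith [exp_sub_one_le hx.le hx1]
  rcases le_total 1 r with hr1 | hr1
  · have h1 := one_add_rpow_one_sub_le hα (u := τ * (r - 1)) (mul_nonneg hτ.le (by linarith))
    have h2 : 0 ≤ α * (α - 1) / 2 * τ ^ 2 * x := by positivity
    beta_reduce
    rw [show 1 - τ + τ * r = 1 + τ * (r - 1) by ring]
    linarith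
  · have h1 := one_sub_rpow_one_sub_le hα (v := τ * (1 - r)) (M := 1 + x)
      (mul_nonneg hτ.le (by linarith)) (by nlinarith)
      (by nlinarith [mul_pos hτ hr, mul_pos (mul_pos hτ hr) hx])
    have h2 : α * (α - 1) / 2 * τ ^ 2 * x * (1 - r) ^ 2 ≤ α * (α - 1) / 2 * τ ^ 2 * x * 1 := by
      gcongr; nlinarith
    beta_reduce
    rw [show 1 - τ + τ * r = 1 - τ * (1 - r) by ring]
    linarith

lemma dominatedByMoments_rpow_of_le_two (hx : 0 < x) (hx1 : x ≤ 9 / 5) (hτ : 0 < τ) (hα : 1 < α)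
    (hα2 : α ≤ 2) (h : α * τ * (1 + x) ≤ x * Real.exp (-(3 / 2 * (α - 1) * x))) :
    DominatedByMoments x τ α (fun r => (1 - τ + τ * r) ^ α) := by
  have h0 := mul_rate_le hx hα h
  have hA : 0 < α * (α - 1) / 2 := by have : 0 < α - 1 := by linarith
                                      positivity
  have hτx : τ * (1 + x) ≤ x := by
    refine le_trans ?_ h0
    rw [mul_assoc]
    exact le_mul_of_one_le_left (by positivity) hα.le
  refine ⟨α, 1, 0, x, 1, by norm_num, le_rfl, le_rfl, ?_, fun r hr => ?_⟩
  · linarith [exp_sub_one_le hx.le hx1]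
  rcases le_total 1 r with hr1 | hr1
  · have h1 := one_add_rpow_le_of_le_two hα hα2 (u := τ * (r - 1))
      (mul_nonneg hτ.le (by linarith))
    have h2 : 0 ≤ α * (α - 1) / 2 * τ ^ 2 * x := by positivity
    beta_reduce
    rw [show 1 - τ + τ * r = 1 + τ * (r - 1) by ring]
    linarith
  · have h1 := one_sub_rpow_le_of_le_two hα hα2 (v := τ * (1 - r)) (M := 1 + x)
      (mul_nonneg hτ.le (by linarith)) (by nlinarith)
      (by nlinarith [mul_pos hτ hr, mul_pos (mul_pos hτ hr) hx])
    have h2 : α * (α - 1) / 2 * τ ^ 2 * x * (1 - r) ^ 2 ≤ α * (α - 1) / 2 * τ ^ 2 * x * 1 := by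
      gcongr; nlinarith
    beta_reduce
    rw [show 1 - τ + τ * r = 1 - τ * (1 - r) by ring]
    linarith

/-- For `α ≥ 2` it suffices to bound `(1 + τ r) ^ (α - 2)`. -/
lemma rpow_le_of_two_le {K B q r : ℝ} (hτ : 0 < τ) (hτ1 : τ < 1) (hα : 2 ≤ α) (hK : 1 ≤ K)
    (hB : 0 ≤ B) (hr : 0 < r) (h : (1 + τ * r) ^ (α - 2) ≤ K + B * r ^ q) :
    (1 - τ + τ * r) ^ α ≤ 1 + α * τ * (r - 1) +
      α * (α - 1) / 2 * τ ^ 2 * (K * (r - 1) ^ 2 + B * r ^ (q + 2) + 0) := by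
  have hA : 0 < α * (α - 1) / 2 := by have : 0 < α - 1 := by linarith
                                      positivity
  have hrq : r ^ (q + 2) = r ^ q * r ^ 2 := by
    rw [Real.rpow_add hr]; norm_num
  have hrq0 : 0 < r ^ q := Real.rpow_pos_of_pos hr q
  rw [add_zero, hrq]
  rcases le_total 1 r with hr1 | hr1
  · have h1 := one_add_rpow_le_of_two_le hα (u := τ * (r - 1)) (mul_nonneg hτ.le (by linarith))
    have h3 : (1 + τ * (r - 1)) ^ (α - 2) ≤ (1 + τ * r) ^ (α - 2) := by
      exact Real.rpow_le_rpow (by nlinarith) (by linarith) (by linarith)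
    rw [show 1 - τ + τ * r = 1 + τ * (r - 1) by ring]
    -- Only the `B` part trades `(r - 1)²` for `r²`; the `K` part must keep its small variance.
    have h4 : (1 + τ * (r - 1)) ^ (α - 2) * (r - 1) ^ 2 ≤
        K * (r - 1) ^ 2 + B * (r ^ q * r ^ 2) := by
      calc _ ≤ (K + B * r ^ q) * (r - 1) ^ 2 := by gcongr; exact h3.trans h
        _ = K * (r - 1) ^ 2 + B * (r ^ q * (r - 1) ^ 2) := by ring
        _ ≤ _ := by gcongr; linarith
    have h5 := mul_le_mul_of_nonneg_left h4 (show 0 ≤ α * (α - 1) / 2 * τ ^ 2 by positivity)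
    linarith
  · have h1 := one_sub_rpow_le_of_two_le hα (v := τ * (1 - r)) (mul_nonneg hτ.le (by linarith))
      (by nlinarith)
    have h4 : (r - 1) ^ 2 ≤ K * (r - 1) ^ 2 + B * (r ^ q * r ^ 2) := by
      have : 0 ≤ B * (r ^ q * r ^ 2) := by positivity
      nlinarith [sq_nonneg (r - 1)]
    have h5 := mul_le_mul_of_nonneg_left h4 (show 0 ≤ α * (α - 1) / 2 * τ ^ 2 by positivity)
    rw [show 1 - τ + τ * r = 1 - τ * (1 - r) by ring]
    linarith

lemma dominatedByMoments_rpow_of_le_three (hx : 0 < x) (hx1 : x ≤ 9 / 5) (hτ : 0 < τ)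
    (hα2 : 2 ≤ α) (hα3 : α ≤ 3)
    (h : α * τ * (1 + x) ≤ x * Real.exp (-(3 / 2 * (α - 1) * x))) :
    DominatedByMoments x τ α (fun r => (1 - τ + τ * r) ^ α) := by
  have h0 := mul_rate_le hx (by linarith) h
  have hτ1 : τ < 1 := by nlinarith [mul_pos hτ hx]
  -- Concave Bernoulli bounds `(1 + τ r) ^ (α - 2)` by `1 + (α - 2) τ r`, hence a third moment. Its
  -- cost is at most `1.1 x`, exactly the slack `4 x - 2.9 x`.
  refine ⟨α, 1, (α - 2) * τ, 0, 1 + 2, by norm_num, mul_nonneg (by linarith) hτ.le, by norm_num, ?_,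
    fun r hr => rpow_le_of_two_le hτ hτ1 hα2 le_rfl (mul_nonneg (by linarith) hτ.le) hr ?_⟩
  · have h1 := mul_exp_le hx1 (p := α - 2) (by linarith) (by linarith)
    have h2 : 2 * τ ≤ x * Real.exp (-(3 / 2 * (α - 1) * x)) := by
      refine le_trans ?_ h
      nlinarith [mul_pos hτ hx, mul_pos (mul_pos hτ hx) (show 0 < α by linarith)]
    have h3 : (α - 2) * τ * Real.exp ((1 + 2) * (1 + 2 - 1) / 2 * x) ≤ x * 1.1 := by
      have h4 : Real.exp (3 / 2 * (1 - (α - 2)) * x) =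
          Real.exp (-(3 / 2 * (α - 1) * x)) * Real.exp ((1 + 2) * (1 + 2 - 1) / 2 * x) := by
        rw [← Real.exp_add]; ring_nf
      rw [h4] at h1
      have h5 : 0 ≤ (α - 2) * Real.exp ((1 + 2) * (1 + 2 - 1) / 2 * x) :=
        mul_nonneg (by linarith) (Real.exp_pos _).le
      nlinarith
    linarith [exp_sub_one_le hx.le hx1]
  · have := rpow_one_add_le_one_add_mul_self (s := τ * r) (p := α - 2)
      (by nlinarith [mul_pos hτ hr]) (by linarith) (by linarith)
    rw [Real.rpow_one]
    linarith

/-- Convexity of the power with weights `1 - l` and `l`, where `l = 1 / (7 p)` is small enough that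
`(1 - l) ^ p ≥ 6 / 7`. The constant stays near 1 because it multiplies the variance: `7/6 * 2.9 +
1/3 < 4`. -/
lemma one_add_rpow_le_split {p y : ℝ} (hp : 1 ≤ p) (hy : 0 ≤ y) :
    (1 + y) ^ p ≤ 7 / 6 + (7 * p) ^ (p - 1) * y ^ p := by
  set l : ℝ := 1 / (7 * p) with hl
  have hp0 : 0 < p := by linarith
  have hl0 : 0 < l := by positivity
  have hl1 : l < 1 := by rw [hl, div_lt_one (by positivity)]; linarith
  have h1l : 0 < 1 - l := by linarith
  obtain ⟨-, hc⟩ := convexOn_rpow hp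
  have h := hc (show (0 : ℝ) ≤ (1 - l)⁻¹ by positivity) (show (0 : ℝ) ≤ l⁻¹ * y by positivity)
    h1l.le hl0.le (by ring)
  simp only [smul_eq_mul] at h
  rw [mul_inv_cancel₀ h1l.ne', mul_inv_cancel_left₀ hl0.ne'] at h
  refine h.trans ?_
  have h2 : 6 / 7 ≤ (1 - l) ^ p := by
    have := one_sub_mul_le_rpow hp hl1.le
    have h3 : p * l = 1 / 7 := by rw [hl]; field_simp
    linarith
  have h3 : (1 - l) * (1 - l)⁻¹ ^ p ≤ 7 / 6 := by
    rw [Real.inv_rpow h1l.le, ← div_eq_mul_inv, div_le_iff₀ (by linarith)]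
    linarith
  have h4 : l * (l⁻¹ * y) ^ p = (7 * p) ^ (p - 1) * y ^ p := by
    rw [Real.mul_rpow (by positivity) hy, ← mul_assoc]
    congr 1
    have : l⁻¹ = 7 * p := by rw [hl]; simp
    rw [this, Real.rpow_sub_one (by positivity), hl]
    field_simp
  linarith

lemma dominatedByMoments_rpow_of_three_le (hx : 0 < x) (hx1 : x ≤ 9 / 5) (hτ : 0 < τ)
    (hα3 : 3 ≤ α)
    (h : α * τ * (1 + x) ≤ x * Real.exp (-(3 / 2 * (α - 1) * x))) :
    DominatedByMoments x τ α (fun r => (1 - τ + τ * r) ^ α) := by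
  have h0 := mul_rate_le hx (by linarith) h
  have hτ1 : τ < 1 := by nlinarith [mul_pos hτ hx]
  set p := α - 2 with hp
  have hp1 : 1 ≤ p := by linarith
  have hp0 : 0 < p := by linarith
  have hB : 0 ≤ (7 * p) ^ (p - 1) * τ ^ p := by positivity
  refine ⟨α, 7 / 6, (7 * p) ^ (p - 1) * τ ^ p, 0, p + 2, by norm_num, hB, by linarith, ?_,
    fun r hr => rpow_le_of_two_le hτ hτ1 (by linarith) (by norm_num) hB hr ?_⟩
  · set e := Real.exp (-(3 / 2 * (α - 1) * x)) with he
    have he0 : 0 < e := Real.exp_pos _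
    have h1 : τ ≤ x * e / 3 := by nlinarith [mul_pos hτ hx]
    have h2 : 7 * p * τ ≤ Real.exp (2 * x) * e := by
      have h3 : p * τ * (1 + x) ≤ x * e := by
        refine le_trans ?_ h
        gcongr
        linarith
      have h4 : 7 * x ≤ (1 + x) * Real.exp (2 * x) := by
        have := Real.quadratic_le_exp_of_nonneg (x := 2 * x) (by linarith)
        have h5 : (1 + x) * (1 + 2 * x + (2 * x) ^ 2 / 2) ≤ (1 + x) * Real.exp (2 * x) := by
          gcongr
        nlinarith [sq_nonneg (1 - 2 * x), pow_pos hx 3]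
      have h6 : 7 * p * τ * (1 + x) ≤ Real.exp (2 * x) * e * (1 + x) := by nlinarith
      exact le_of_mul_le_mul_right h6 (by linarith)
    have h3 : (7 * p) ^ (p - 1) * τ ^ p * Real.exp ((p + 2) * (p + 2 - 1) / 2 * x) ≤ x / 3 := by
      have h4 : (7 * p) ^ (p - 1) * τ ^ p = (7 * p * τ) ^ (p - 1) * τ := by
        rw [Real.mul_rpow (by positivity) hτ.le, mul_assoc, ← Real.rpow_add_one hτ.ne']
        ring_nf
      have h5 : (7 * p * τ) ^ (p - 1) ≤ (Real.exp (2 * x) * e) ^ (p - 1) :=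
        Real.rpow_le_rpow (by positivity) h2 (by linarith)
      -- The exponents of `x` add up to a negative square. The rate `3/2` in `e` gives `-(3/2) p²`,
      -- which outweighs the `p² / 2` from the moment of order `p + 2 = α`.
      have h6 : (Real.exp (2 * x) * e) ^ (p - 1) * (x * e / 3) *
          Real.exp ((p + 2) * (p + 2 - 1) / 2 * x) =
          x / 3 * Real.exp (-((p - 1) ^ 2 * x)) := by
        have : (Real.exp (2 * x) * e) ^ (p - 1) * e * Real.exp ((p + 2) * (p + 2 - 1) / 2 * x) =
            Real.exp (-((p - 1) ^ 2 * x)) := by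
          rw [he, ← Real.exp_add, ← Real.exp_mul, ← Real.exp_add, ← Real.exp_add, hp]
          ring_nf
        rw [← this]; ring
      rw [h4]
      calc _ ≤ (Real.exp (2 * x) * e) ^ (p - 1) * (x * e / 3) *
          Real.exp ((p + 2) * (p + 2 - 1) / 2 * x) := by gcongr
        _ = _ := h6
        _ ≤ x / 3 * 1 := by
          gcongr
          rw [Real.exp_le_one_iff]
          have : 0 ≤ (p - 1) ^ 2 * x := by positivity
          linarith
        _ = x / 3 := mul_one _
    linarith [exp_sub_one_le hx.le hx1]
  · refine (one_add_rpow_le_split hp1 (by positivity)).trans (le_of_eq ?_)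
    rw [Real.mul_rpow hτ.le hr.le]; ring

lemma dominatedByMoments_rpow (hx : 0 < x) (hx1 : x ≤ 9 / 5) (hτ : 0 < τ) (hα : 1 < α)
    (h : α * τ * (1 + x) ≤ x * Real.exp (-(3 / 2 * (α - 1) * x))) :
    DominatedByMoments x τ α (fun r => (1 - τ + τ * r) ^ α) := by
  rcases le_total α 2 with h2 | h2
  · exact dominatedByMoments_rpow_of_le_two hx hx1 hτ hα h2 h
  rcases le_total α 3 with h3 | h3
  · exact dominatedByMoments_rpow_of_le_three hx hx1 hτ h2 h3 h
  · exact dominatedByMoments_rpow_of_three_le hx hx1 hτ h3 h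

end LikelihoodRatioBounds

/-! ### Cameron-Martin formula and likelihood-ratio moments for isotropic Gaussians. -/

section IsotropicGaussian

open scoped RealInnerProductSpace

variable {ι : Type*}

/-- The isotropic Gaussian distribution `𝒩(v, ν² I)`. -/
noncomputable abbrev isoGaussian [Fintype ι] [DecidableEq ι] (ν : ℝ) (v : EuclideanSpace ℝ ι) :
    Measure (EuclideanSpace ℝ ι) :=
  multivariateGaussian v (ν ^ 2 • (1 : Matrix ι ι ℝ))

lemma posSemidef_sq_smul_one [DecidableEq ι] (ν : ℝ) : (ν ^ 2 • (1 : Matrix ι ι ℝ)).PosSemidef :=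
  Matrix.PosSemidef.one.smul (sq_nonneg ν)

variable [Fintype ι]

lemma charFun_isoGaussian [DecidableEq ι] (ν : ℝ) (v t : EuclideanSpace ℝ ι) :
    charFun (isoGaussian ν v) t =
      Complex.exp (⟪t, v⟫ * Complex.I - ν ^ 2 * ∑ i, (t i : ℂ) ^ 2 / 2) := by
  rw [charFun_multivariateGaussian (posSemidef_sq_smul_one ν)]
  congr 2
  simp [Matrix.smul_mulVec, dotProduct, Finset.mul_sum, Finset.sum_div]
  exact Finset.sum_congr rfl fun i _ => by ring

lemma isoGaussian_zero_eq_map [DecidableEq ι] (ν : ℝ) :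
    isoGaussian ν (0 : EuclideanSpace ℝ ι) =
      (stdGaussian (EuclideanSpace ℝ ι)).map (fun x => ν • x) := by
  apply Measure.ext_of_charFun
  ext t
  rw [charFun_isoGaussian, charFun_map_smul, charFun_stdGaussian, norm_smul,
    Complex.ofReal_mul, mul_pow, ← Complex.ofReal_pow ‖t‖, ← Complex.ofReal_pow ‖ν‖, Real.norm_eq_abs,
    sq_abs, EuclideanSpace.real_norm_sq_eq]
  congr 1
  simp [Finset.mul_sum, Finset.sum_div, ← Finset.sum_neg_distrib]
  exact Finset.sum_congr rfl fun i _ => by ring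

lemma integral_cexp_stdGaussian (z : ι → ℂ) :
    ∫ x, Complex.exp (∑ i, z i * (x i : ℂ)) ∂(stdGaussian (EuclideanSpace ℝ ι)) =
      Complex.exp (∑ i, z i ^ 2 / 2) := by
  rw [← map_pi_eq_stdGaussian, integral_map (by fun_prop)
    (Measurable.aestronglyMeasurable (by fun_prop))]
  simp_rw [Complex.exp_sum]
  rw [integral_fintype_prod_eq_prod (f := fun i (x : ℝ) => Complex.exp (z i * x))]
  refine Finset.prod_congr rfl fun i _ => ?_
  have := complexMGF_id_gaussianReal (μ := 0) (v := 1) (z i)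
  simpa [complexMGF] using this

/-- Complex exponents are needed because the characteristic function of an exponentially tilted
Gaussian mixes a real and an imaginary linear form. -/
lemma integral_cexp_isoGaussian [DecidableEq ι] (ν : ℝ) (z : ι → ℂ) :
    ∫ x, Complex.exp (∑ i, z i * (x i : ℂ)) ∂(isoGaussian ν (0 : EuclideanSpace ℝ ι)) =
      Complex.exp (ν ^ 2 * ∑ i, z i ^ 2 / 2) := by
  rw [isoGaussian_zero_eq_map, integral_map (by fun_prop)
    (Measurable.aestronglyMeasurable (by fun_prop))]
  calc _ = ∫ x, Complex.exp (∑ i, (ν * z i) * (x i : ℂ)) ∂(stdGaussian (EuclideanSpace ℝ ι)) := by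
        refine integral_congr_ae (ae_of_all _ fun x => ?_)
        refine congrArg Complex.exp (Finset.sum_congr rfl fun i _ => ?_)
        simp; ring
    _ = _ := by
        rw [integral_cexp_stdGaussian, Finset.mul_sum]
        exact congrArg Complex.exp (Finset.sum_congr rfl fun i _ => by ring)

/-- The density of `𝒩(v, ν² I)` with respect to `𝒩(0, ν² I)`. -/
noncomputable def gaussianLR (ν : ℝ) (v x : EuclideanSpace ℝ ι) : ℝ :=
  Real.exp ((⟪v, x⟫ - ‖v‖ ^ 2 / 2) / ν ^ 2)

lemma gaussianLR_pos (ν : ℝ) (v x : EuclideanSpace ℝ ι) : 0 < gaussianLR ν v x := Real.exp_pos _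

@[fun_prop]
lemma measurable_gaussianLR (ν : ℝ) (v : EuclideanSpace ℝ ι) : Measurable (gaussianLR ν v) := by
  unfold gaussianLR
  fun_prop

lemma integral_exp_inner_isoGaussian [DecidableEq ι] {ν : ℝ} (hν : ν ≠ 0) (v : EuclideanSpace ℝ ι) :
    ∫ x, Real.exp (⟪v, x⟫ / ν ^ 2) ∂(isoGaussian ν (0 : EuclideanSpace ℝ ι)) =
      Real.exp (‖v‖ ^ 2 / 2 / ν ^ 2) := by
  have h := integral_cexp_isoGaussian ν (fun i => ((v i / ν ^ 2 : ℝ) : ℂ))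
  have h1 : ∀ x : EuclideanSpace ℝ ι, Complex.exp (∑ i, ((v i / ν ^ 2 : ℝ) : ℂ) * (x i : ℂ)) =
      ((Real.exp (⟪v, x⟫ / ν ^ 2) : ℝ) : ℂ) := by
    intro x
    rw [PiLp.inner_apply]
    push_cast
    congr 1
    rw [Finset.sum_div]
    exact Finset.sum_congr rfl fun i _ => by simp; ring
  simp_rw [h1] at h
  rw [integral_complex_ofReal] at h
  have h2 : Complex.exp (ν ^ 2 * ∑ i, ((v i / ν ^ 2 : ℝ) : ℂ) ^ 2 / 2) =
      ((Real.exp (‖v‖ ^ 2 / 2 / ν ^ 2) : ℝ) : ℂ) := by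
    rw [EuclideanSpace.real_norm_sq_eq]
    push_cast
    congr 1
    rw [Finset.mul_sum, Finset.sum_div, Finset.sum_div]
    refine Finset.sum_congr rfl fun i _ => ?_
    have : (ν : ℂ) ≠ 0 := by exact_mod_cast hν
    field_simp
  rw [h2] at h
  exact_mod_cast h

lemma integrable_exp_inner_isoGaussian [DecidableEq ι] {ν : ℝ} (hν : ν ≠ 0) (v : EuclideanSpace ℝ ι) :
    Integrable (fun x => Real.exp (⟪v, x⟫ / ν ^ 2)) (isoGaussian ν (0 : EuclideanSpace ℝ ι)) := by
  -- The Bochner integral of a non-integrable function is `0`, whereas this one is positive.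
  by_contra h
  have := integral_exp_inner_isoGaussian hν v
  rw [integral_undef h] at this
  exact (Real.exp_pos _).ne this

/-- The Cameron-Martin formula for isotropic Gaussian distributions. -/
lemma isoGaussian_eq_withDensity [DecidableEq ι] {ν : ℝ} (hν : ν ≠ 0) (v : EuclideanSpace ℝ ι) :
    isoGaussian ν v =
      (isoGaussian ν 0).withDensity (fun x => ENNReal.ofReal (gaussianLR ν v x)) := by
  -- The density is an exponential tilt with its normalising constant, so comparing characteristic
  -- functions suffices.
  have h1 : (isoGaussian ν 0).withDensity (fun x => ENNReal.ofReal (gaussianLR ν v x)) =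
      (isoGaussian ν 0).tilted (fun x => ⟪v, x⟫ / ν ^ 2) := by
    rw [Measure.tilted, integral_exp_inner_isoGaussian hν]
    simp_rw [← Real.exp_sub, gaussianLR, sub_div]
  rw [h1]
  have := isProbabilityMeasure_tilted (integrable_exp_inner_isoGaussian hν v)
  apply Measure.ext_of_charFun
  ext t
  rw [charFun_isoGaussian, charFun_apply, integral_tilted, integral_exp_inner_isoGaussian hν]
  have h := integral_cexp_isoGaussian ν (fun i => ((v i / ν ^ 2 : ℝ) : ℂ) + t i * Complex.I)
  have h2 : ∀ x : EuclideanSpace ℝ ι,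
      (Real.exp (⟪v, x⟫ / ν ^ 2) / Real.exp (‖v‖ ^ 2 / 2 / ν ^ 2)) •
        Complex.exp (⟪x, t⟫ * Complex.I) =
      Complex.exp (-(‖v‖ ^ 2 / 2 / ν ^ 2 : ℝ)) *
        Complex.exp (∑ i, (((v i / ν ^ 2 : ℝ) : ℂ) + t i * Complex.I) * (x i : ℂ)) := by
    intro x
    rw [← Real.exp_sub, Complex.real_smul, Complex.ofReal_exp, ← Complex.exp_add,
      ← Complex.exp_add, PiLp.inner_apply, PiLp.inner_apply]
    congr 1
    push_cast
    simp only [add_mul, Finset.sum_add_distrib, Finset.sum_div, Finset.sum_mul, sub_eq_add_neg]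
    have e1 : ∑ i, (((inner ℝ (v i) (x i) : ℝ) : ℂ)) / (ν : ℂ) ^ 2 =
        ∑ i, (v i : ℂ) / (ν : ℂ) ^ 2 * x i :=
      Finset.sum_congr rfl fun i _ => by simp; ring
    have e2 : ∑ i, (((inner ℝ (x i) (t i) : ℝ) : ℂ)) * Complex.I =
        ∑ i, (t i : ℂ) * Complex.I * x i :=
      Finset.sum_congr rfl fun i _ => by simp; ring
    rw [e1, e2]
    ring
  simp_rw [h2]
  rw [integral_const_mul, h, ← Complex.exp_add, EuclideanSpace.real_norm_sq_eq, PiLp.inner_apply]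
  congr 1
  push_cast
  simp only [Finset.mul_sum, Finset.sum_mul, Finset.sum_div, ← Finset.sum_sub_distrib,
    ← Finset.sum_neg_distrib, ← Finset.sum_add_distrib]
  refine Finset.sum_congr rfl fun i _ => ?_
  have : (ν : ℂ) ≠ 0 := by exact_mod_cast hν
  have hI := Complex.I_sq
  simp
  field_simp
  linear_combination (-(t i : ℂ) ^ 2 * (ν : ℂ) ^ 4) * hI

lemma lintegral_gaussianLR [DecidableEq ι] {ν : ℝ} (hν : ν ≠ 0) (v : EuclideanSpace ℝ ι) :
    ∫⁻ x, ENNReal.ofReal (gaussianLR ν v x) ∂(isoGaussian ν 0) = 1 := by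
  rw [← setLIntegral_univ, ← withDensity_apply _ MeasurableSet.univ,
    ← isoGaussian_eq_withDensity hν, measure_univ]

/-- Moments of the likelihood ratio between two isotropic Gaussian distributions. -/
lemma lintegral_likelihoodRatio_rpow [DecidableEq ι] {ν : ℝ} (hν : ν ≠ 0) (v w : EuclideanSpace ℝ ι) (s : ℝ) :
    ∫⁻ x, ENNReal.ofReal ((gaussianLR ν w x / gaussianLR ν v x) ^ s) ∂(isoGaussian ν v) =
      ENNReal.ofReal (Real.exp (s * (s - 1) / 2 * (‖v - w‖ ^ 2 / ν ^ 2))) := by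
  rw [isoGaussian_eq_withDensity hν v, lintegral_withDensity_eq_lintegral_mul _ (by fun_prop)
    (by fun_prop)]
  -- Completing the square: `LR_w ^ s * LR_v ^ (1 - s)` is a constant times the density of the
  -- Gaussian centred at `(1 - s) v + s w`, which has mass one.
  have h : ∀ x, ((fun x => ENNReal.ofReal (gaussianLR ν v x)) * fun x =>
        ENNReal.ofReal ((gaussianLR ν w x / gaussianLR ν v x) ^ s)) x =
      ENNReal.ofReal (Real.exp (s * (s - 1) / 2 * (‖v - w‖ ^ 2 / ν ^ 2))) *
        ENNReal.ofReal (gaussianLR ν ((1 - s) • v + s • w) x) := by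
    intro x
    rw [Pi.mul_apply, ← ENNReal.ofReal_mul (gaussianLR_pos ν v x).le,
      ← ENNReal.ofReal_mul (Real.exp_pos _).le]
    congr 1
    simp only [gaussianLR]
    rw [← Real.exp_sub, ← Real.exp_mul, ← Real.exp_add, ← Real.exp_add, norm_sub_sq_real,
      norm_add_sq_real, inner_add_left, real_inner_smul_left, real_inner_smul_left,
      real_inner_smul_left, real_inner_smul_right, norm_smul, norm_smul, mul_pow, mul_pow]
    congr 1
    simp only [Real.norm_eq_abs, sq_abs]
    field_simp
    ring
  simp_rw [h]
  rw [lintegral_const_mul _ (by fun_prop), lintegral_gaussianLR hν, mul_one]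

end IsotropicGaussian

/-! ### From moment bounds to Rényi divergence, and mixtures. -/

section RenyiDivergence

/-- The expectation of a function of the likelihood ratio that is dominated by moments. -/
lemma lintegral_le_of_dominatedByMoments {Ω : Type*} [MeasurableSpace Ω] {ρ : Measure Ω}
    [IsProbabilityMeasure ρ] {r : Ω → ℝ} (hr : Measurable r) (hr0 : ∀ ω, 0 < r ω) {x x' τ α : ℝ}
    (hx : x' ≤ x) (hα : 1 < α)
    (hmom : ∀ s : ℝ, ∫⁻ ω, ENNReal.ofReal (r ω ^ s) ∂ρ =
      ENNReal.ofReal (Real.exp (s * (s - 1) / 2 * x')))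
    {F : ℝ → ℝ} (hF0 : ∀ t, 0 < t → 0 ≤ F t) (hF : DominatedByMoments x τ α F) :
    ∫⁻ ω, ENNReal.ofReal (F (r ω)) ∂ρ ≤ ENNReal.ofReal (1 + 2 * α * (α - 1) * τ ^ 2 * x) := by
  obtain ⟨s, K, B, D, m, hK, hB, hm, hle, hdom⟩ := hF
  have hint : ∀ s : ℝ, Integrable (fun ω => r ω ^ s) ρ := fun s => by
    refine ⟨(by fun_prop : Measurable _).aestronglyMeasurable, ?_⟩
    rw [hasFiniteIntegral_iff_ofReal (ae_of_all _ fun ω => (Real.rpow_pos_of_pos (hr0 ω) s).le),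
      hmom]
    exact ENNReal.ofReal_lt_top
  have hval : ∀ s : ℝ, ∫ ω, r ω ^ s ∂ρ = Real.exp (s * (s - 1) / 2 * x') := fun s => by
    rw [integral_eq_lintegral_of_nonneg_ae
      (ae_of_all _ fun ω => (Real.rpow_pos_of_pos (hr0 ω) s).le)
      (hint s).aestronglyMeasurable, hmom, ENNReal.toReal_ofReal (Real.exp_pos _).le]
  have hi1 : Integrable r ρ := by simpa using hint 1
  have hv1 : ∫ ω, r ω ∂ρ = 1 := by simpa using hval 1
  have hi2 : Integrable (fun ω => r ω ^ 2) ρ := by simpa using hint 2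
  have hv2 : ∫ ω, r ω ^ 2 ∂ρ = Real.exp x' := by
    have := hval 2
    norm_num at this
    exact this
  set A := α * (α - 1) / 2 * τ ^ 2 with hA
  have hA0 : 0 ≤ A := by
    have : 0 < α - 1 := by linarith
    positivity
  let G : Ω → ℝ := fun ω => (1 - s * τ + A * K + A * D) + (s * τ - 2 * A * K) * r ω +
    A * K * r ω ^ 2 + A * B * r ω ^ m
  have hj1 : Integrable (fun ω => (s * τ - 2 * A * K) * r ω) ρ := hi1.const_mul _
  have hj2 : Integrable (fun ω => A * K * r ω ^ 2) ρ := hi2.const_mul _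
  have hj3 : Integrable (fun ω => A * B * r ω ^ m) ρ := (hint m).const_mul _
  have hj0 : Integrable (fun _ : Ω => 1 - s * τ + A * K + A * D) ρ := integrable_const _
  have hG : Integrable G ρ := ((hj0.add hj1).add hj2).add hj3
  have hGv : ∫ ω, G ω ∂ρ = 1 + A * (K * (Real.exp x' - 1) +
      B * Real.exp (m * (m - 1) / 2 * x') + D) := by
    simp only [G]
    have e2 := integral_add (hj0.add hj1) hj2
    have e3 := integral_add ((hj0.add hj1).add hj2) hj3
    simp only [Pi.add_apply] at e2 e3
    rw [e3, e2, integral_add hj0 hj1, integral_const_mul, integral_const_mul, integral_const_mul, hv1, hv2,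
      hval m, integral_const]
    simp
    ring
  have hFG : ∀ ω, F (r ω) ≤ G ω := fun ω =>
    (hdom _ (hr0 ω)).trans (le_of_eq (by simp only [G]; ring))
  calc ∫⁻ ω, ENNReal.ofReal (F (r ω)) ∂ρ ≤ ∫⁻ ω, ENNReal.ofReal (G ω) ∂ρ :=
        lintegral_mono fun ω => ENNReal.ofReal_le_ofReal (hFG ω)
    _ = ENNReal.ofReal (∫ ω, G ω ∂ρ) := (ofReal_integral_eq_lintegral_ofReal hG
        (ae_of_all _ fun ω => (hF0 _ (hr0 ω)).trans (hFG ω))).symm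
    _ ≤ _ := ENNReal.ofReal_le_ofReal ?_
  -- Sensitivity only bounds `x'` above by `x`; the signs of `K`, `B` and `m - 1` make the left side
  -- monotone.
  have h1 : K * (Real.exp x' - 1) + B * Real.exp (m * (m - 1) / 2 * x') + D ≤ 4 * x := by
    refine le_trans ?_ hle
    have : 0 ≤ m * (m - 1) / 2 := by
      have : 0 ≤ m - 1 := by linarith
      positivity
    gcongr
  rw [hGv]
  calc _ ≤ 1 + A * (4 * x) := by gcongr
    _ = _ := by rw [hA]; ring

/-- A Rényi divergence bound from a bound on the moment of the Radon-Nikodym derivative. -/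
lemma renyiDiv_le {Ω : Type*} [MeasurableSpace Ω] {P Q : Measure Ω} {α c : ℝ} (hα : 1 < α)
    (hPQ : P ≪ Q) (h : ∫⁻ ω, P.rnDeriv Q ω ^ α ∂Q ≤ ENNReal.ofReal (1 + (α - 1) * c)) :
    renyiDiv α P Q ≤ (c : EReal) := by
  rw [renyiDiv, if_pos hPQ]
  have h1 : ENNReal.log (∫⁻ ω, P.rnDeriv Q ω ^ α ∂Q) ≤ (((α - 1) * c : ℝ) : EReal) := by
    calc _ ≤ ENNReal.log (ENNReal.ofReal (Real.exp ((α - 1) * c))) := by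
          refine ENNReal.log_le_log (h.trans (ENNReal.ofReal_le_ofReal ?_))
          linarith [Real.add_one_le_exp ((α - 1) * c)]
      _ = _ := by rw [ENNReal.log_ofReal_of_pos (Real.exp_pos _), Real.log_exp]
  have h0 : 0 < α - 1 := by linarith
  calc _ ≤ ((1 / (α - 1) : ℝ) : EReal) * (((α - 1) * c : ℝ) : EReal) :=
        mul_le_mul_of_nonneg_left h1 (by exact_mod_cast (by positivity))
    _ = (c : EReal) := by
        rw [← EReal.coe_mul]
        congr 1
        field_simp

lemma renyiDiv_self_le {Ω : Type*} [MeasurableSpace Ω] (P : Measure Ω) [IsProbabilityMeasure P]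
    {α c : ℝ} (hα : 1 < α) (hc : 0 ≤ c) : renyiDiv α P P ≤ (c : EReal) := by
  refine renyiDiv_le hα Measure.AbsolutelyContinuous.rfl ?_
  rw [lintegral_congr_ae (g := fun _ => 1)
    (by filter_upwards [P.rnDeriv_self] with ω hω; simp [hω])]
  simp only [lintegral_const, measure_univ, mul_one]
  rw [ENNReal.one_le_ofReal]
  nlinarith

/-- Joint convexity of `(p, q) ↦ (p / q) ^ α * q`. -/
lemma sum_div_rpow_mul_le {ι : Type*} (s : Finset ι) (w p q : ι → ℝ≥0∞) {α : ℝ} (hα : 1 ≤ α)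
    (hq0 : ∀ i ∈ s, q i ≠ 0) (hqt : ∀ i ∈ s, q i ≠ ⊤)
    (hs0 : ∑ i ∈ s, w i * q i ≠ 0) (hst : ∑ i ∈ s, w i * q i ≠ ⊤) :
    ((∑ i ∈ s, w i * p i) / ∑ i ∈ s, w i * q i) ^ α * ∑ i ∈ s, w i * q i ≤
      ∑ i ∈ s, w i * ((p i / q i) ^ α * q i) := by
  set t := ∑ i ∈ s, w i * q i with ht
  have h1 : ∑ i ∈ s, w i * q i / t = 1 := by
    simp_rw [div_eq_mul_inv]
    rw [← Finset.sum_mul, ← ht, ENNReal.mul_inv_cancel hs0 hst]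
  -- Jensen at the points `p i / q i`, with weights the posterior probabilities `w i * q i / t`.
  have h2 := ENNReal.rpow_arith_mean_le_arith_mean_rpow s (fun i => w i * q i / t)
    (fun i => p i / q i) h1 hα
  have h3 : ∑ i ∈ s, w i * q i / t * (p i / q i) = (∑ i ∈ s, w i * p i) / t := by
    simp_rw [div_eq_mul_inv]
    rw [Finset.sum_mul]
    refine Finset.sum_congr rfl fun i hi => ?_
    calc _ = w i * p i * t⁻¹ * (q i * (q i)⁻¹) := by ring
      _ = _ := by rw [ENNReal.mul_inv_cancel (hq0 i hi) (hqt i hi), mul_one]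
  rw [h3] at h2
  calc _ ≤ (∑ i ∈ s, w i * q i / t * (p i / q i) ^ α) * t := by gcongr
    _ = _ := by
      rw [Finset.sum_mul]
      refine Finset.sum_congr rfl fun i _ => ?_
      rw [div_eq_mul_inv]
      calc _ = w i * q i * (p i / q i) ^ α * (t⁻¹ * t) := by ring
        _ = _ := by rw [ENNReal.inv_mul_cancel hs0 hst]; ring

lemma sum_smul_withDensity {Ω ι : Type*} [MeasurableSpace Ω] (μ : Measure Ω) (s : Finset ι)
    (w : ι → ℝ≥0∞) (p : ι → Ω → ℝ≥0∞) (hp : ∀ i, Measurable (p i)) :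
    ∑ i ∈ s, w i • μ.withDensity (p i) = μ.withDensity (fun ω => ∑ i ∈ s, w i * p i ω) := by
  ext A hA
  rw [withDensity_apply _ hA, lintegral_finsetSum _ fun i _ => (hp i).const_mul _,
    Measure.finsetSum_apply]
  refine Finset.sum_congr rfl fun i _ => ?_
  rw [Measure.smul_apply, withDensity_apply _ hA, lintegral_const_mul _ (hp i), smul_eq_mul]

/-- Quasi-convexity of the Rényi divergence for mixtures. -/
lemma renyi_moment_mixture_le {Ω ι : Type*} [MeasurableSpace Ω] (μ : Measure Ω) [SigmaFinite μ]
    (s : Finset ι) (w : ι → ℝ≥0∞) (p q : ι → Ω → ℝ≥0∞) (hp : ∀ i, Measurable (p i))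
    (hq : ∀ i, Measurable (q i)) (hq0 : ∀ i ω, q i ω ≠ 0) (hqt : ∀ i ω, q i ω ≠ ⊤)
    (hw : ∑ i ∈ s, w i = 1) {α : ℝ} (hα : 1 ≤ α) {C : ℝ≥0∞}
    (hC : ∀ i ∈ s, ∫⁻ ω, (p i ω / q i ω) ^ α * q i ω ∂μ ≤ C) :
    ∑ i ∈ s, w i • μ.withDensity (p i) ≪ ∑ i ∈ s, w i • μ.withDensity (q i) ∧
      ∫⁻ ω, (∑ i ∈ s, w i • μ.withDensity (p i)).rnDeriv
        (∑ i ∈ s, w i • μ.withDensity (q i)) ω ^ α ∂(∑ i ∈ s, w i • μ.withDensity (q i)) ≤ C := by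
  rw [sum_smul_withDensity μ s w p hp, sum_smul_withDensity μ s w q hq]
  set P : Ω → ℝ≥0∞ := fun ω => ∑ i ∈ s, w i * p i ω with hP
  set Q : Ω → ℝ≥0∞ := fun ω => ∑ i ∈ s, w i * q i ω with hQ
  have hPm : Measurable P := by fun_prop
  have hQm : Measurable Q := by fun_prop
  have hm : Measurable (fun ω => P ω / Q ω) := hPm.div hQm
  have hwt : ∀ i ∈ s, w i ≠ ⊤ := fun i hi h => by
    have := ENNReal.sum_ne_top.1 (hw ▸ ENNReal.one_ne_top) i hi
    exact this h
  have hQ0 : ∀ ω, Q ω ≠ 0 := fun ω h => by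
    rw [hQ, Finset.sum_eq_zero_iff] at h
    have : ∑ i ∈ s, w i = 0 := Finset.sum_eq_zero fun i hi =>
      (mul_eq_zero.1 (h i hi)).resolve_right (hq0 i ω)
    simp [this] at hw
  have hQt : ∀ ω, Q ω ≠ ⊤ := fun ω =>
    ENNReal.sum_ne_top.2 fun i hi => ENNReal.mul_ne_top (hwt i hi) (hqt i ω)
  have hPQ : μ.withDensity P = (μ.withDensity Q).withDensity (fun ω => P ω / Q ω) := by
    rw [← withDensity_mul _ hQm hm]
    congr 1
    ext ω
    exact (ENNReal.mul_div_cancel (hQ0 ω) (hQt ω)).symm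
  have : SigmaFinite (μ.withDensity Q) := SigmaFinite.withDensity_of_ne_top (ae_of_all _ hQt)
  rw [hPQ]
  refine ⟨withDensity_absolutelyContinuous _ _, ?_⟩
  have hae := Measure.rnDeriv_withDensity (μ.withDensity Q) hm
  rw [lintegral_congr_ae (g := fun ω => (P ω / Q ω) ^ α)
    (by filter_upwards [hae] with ω hω; rw [hω]),
    lintegral_withDensity_eq_lintegral_mul _ hQm (hm.pow_const α)]
  calc _ ≤ ∫⁻ ω, ∑ i ∈ s, w i * ((p i ω / q i ω) ^ α * q i ω) ∂μ := by
        refine lintegral_mono fun ω => ?_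
        simp only [Pi.mul_apply]
        rw [mul_comm]
        exact sum_div_rpow_mul_le s w (fun i => p i ω) (fun i => q i ω) hα
          (fun i _ => hq0 i ω) (fun i _ => hqt i ω) (hQ0 ω) (hQt ω)
    _ = ∑ i ∈ s, w i * ∫⁻ ω, (p i ω / q i ω) ^ α * q i ω ∂μ := by
        rw [lintegral_finsetSum _ fun i _ => by fun_prop]
        exact Finset.sum_congr rfl fun i _ => lintegral_const_mul _ (by fun_prop)
    _ ≤ ∑ i ∈ s, w i * C := by gcongr with i hi; exact hC i hi
    _ = C := by rw [← Finset.sum_mul, hw, one_mul]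

end RenyiDivergence

/-! ### One Gaussian against a two-component mixture. -/

section GaussianPair

variable {ι : Type*} [Fintype ι] {ν τ α : ℝ}

/-- The density of `(1 - τ) 𝒩(v, ν² I) + τ 𝒩(w, ν² I)` with respect to `𝒩(0, ν² I)`. -/
noncomputable def mixtureLR (ν τ : ℝ) (v w x : EuclideanSpace ℝ ι) : ℝ :=
  (1 - τ) * gaussianLR ν v x + τ * gaussianLR ν w x

lemma mixtureLR_pos (hτ : 0 < τ) (hτ1 : τ < 1) (v w x : EuclideanSpace ℝ ι) :
    0 < mixtureLR ν τ v w x := by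
  have h1 := gaussianLR_pos ν v x
  have h2 := gaussianLR_pos ν w x
  have h3 : 0 < 1 - τ := by linarith
  unfold mixtureLR
  positivity

lemma mixtureLR_eq_mul (v w x : EuclideanSpace ℝ ι) :
    mixtureLR ν τ v w x =
      (1 - τ + τ * (gaussianLR ν w x / gaussianLR ν v x)) * gaussianLR ν v x := by
  have h1 := (gaussianLR_pos ν v x).ne'
  rw [mixtureLR]
  field_simp

@[fun_prop]
lemma measurable_mixtureLR (v w : EuclideanSpace ℝ ι) : Measurable (mixtureLR ν τ v w) := by
  unfold mixtureLR
  fun_prop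

lemma withDensity_mixtureLR [DecidableEq ι] (hν : ν ≠ 0) (hτ : 0 < τ) (hτ1 : τ < 1)
    (v w : EuclideanSpace ℝ ι) :
    (isoGaussian ν 0).withDensity (fun x => ENNReal.ofReal (mixtureLR ν τ v w x)) =
      ENNReal.ofReal (1 - τ) • isoGaussian ν v + ENNReal.ofReal τ • isoGaussian ν w := by
  have h3 : 0 ≤ 1 - τ := by linarith
  rw [isoGaussian_eq_withDensity hν v, isoGaussian_eq_withDensity hν w,
    ← withDensity_smul _ (by fun_prop), ← withDensity_smul _ (by fun_prop),
    ← withDensity_add_left (by fun_prop)]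
  congr 1
  ext x
  simp only [Pi.add_apply, Pi.smul_apply, smul_eq_mul]
  rw [← ENNReal.ofReal_mul h3, ← ENNReal.ofReal_mul hτ.le, ← ENNReal.ofReal_add]
  · rfl
  · exact mul_nonneg h3 (gaussianLR_pos ν v x).le
  · exact mul_nonneg hτ.le (gaussianLR_pos ν w x).le

lemma lintegral_comp_likelihoodRatio_le [DecidableEq ι] (hν : ν ≠ 0) (hα : 1 < α)
    {v w : EuclideanSpace ℝ ι} (hvw : ‖v - w‖ ≤ 1) {F : ℝ → ℝ} (hFm : Measurable F)
    (hF0 : ∀ t, 0 < t → 0 ≤ F t) (hF : DominatedByMoments (1 / ν ^ 2) τ α F) :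
    ∫⁻ x, ENNReal.ofReal (F (gaussianLR ν w x / gaussianLR ν v x) * gaussianLR ν v x)
      ∂(isoGaussian ν 0) ≤ ENNReal.ofReal (1 + 2 * α * (α - 1) * τ ^ 2 * (1 / ν ^ 2)) := by
  refine le_trans (le_of_eq ?_) (lintegral_le_of_dominatedByMoments
    (r := fun x => gaussianLR ν w x / gaussianLR ν v x)
    (x' := ‖v - w‖ ^ 2 / ν ^ 2) (by fun_prop)
    (fun x => div_pos (gaussianLR_pos ν w x) (gaussianLR_pos ν v x)) ?_ hα
    (lintegral_likelihoodRatio_rpow hν v w) hF0 hF)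
  · rw [isoGaussian_eq_withDensity hν v,
      lintegral_withDensity_eq_lintegral_mul _ (by fun_prop) (by fun_prop)]
    refine lintegral_congr fun x => ?_
    rw [Pi.mul_apply, mul_comm, ENNReal.ofReal_mul (gaussianLR_pos ν v x).le]
  · gcongr
    exact pow_le_one₀ (norm_nonneg _) hvw

lemma renyi_moment_mixture_gaussian_le [DecidableEq ι] (hν : ν ≠ 0) (hα : 1 < α) (hτ : 0 < τ)
    (hτ1 : τ < 1) {v w : EuclideanSpace ℝ ι} (hvw : ‖v - w‖ ≤ 1)
    (hF : DominatedByMoments (1 / ν ^ 2) τ α (fun r => (1 - τ + τ * r) ^ α)) :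
    ∫⁻ x, (ENNReal.ofReal (mixtureLR ν τ v w x) / ENNReal.ofReal (gaussianLR ν v x)) ^ α *
      ENNReal.ofReal (gaussianLR ν v x) ∂(isoGaussian ν 0) ≤
      ENNReal.ofReal (1 + 2 * α * (α - 1) * τ ^ 2 * (1 / ν ^ 2)) := by
  have h3 : 0 < 1 - τ := by linarith
  refine le_trans (le_of_eq (lintegral_congr fun x => ?_))
    (lintegral_comp_likelihoodRatio_le hν hα hvw (by fun_prop) (fun t ht => by positivity) hF)
  have hg := gaussianLR_pos ν v x
  rw [← ENNReal.ofReal_div_of_pos hg, mixtureLR_eq_mul, mul_div_cancel_right₀ _ hg.ne',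
    ENNReal.ofReal_rpow_of_pos, ← ENNReal.ofReal_mul' hg.le]
  have := div_pos (gaussianLR_pos ν w x) hg
  positivity

/-- The mixture has density `y * g`, where `g` is the density at `v` and `y = 1 - τ + τ r`; then `(g
/ (y g)) ^ α * (y g) = y ^ (1 - α) * g`. -/
lemma renyi_moment_gaussian_mixture_le [DecidableEq ι] (hν : ν ≠ 0) (hα : 1 < α) (hτ : 0 < τ)
    (hτ1 : τ < 1) {v w : EuclideanSpace ℝ ι} (hvw : ‖v - w‖ ≤ 1)
    (hF : DominatedByMoments (1 / ν ^ 2) τ α (fun r => (1 - τ + τ * r) ^ (1 - α))) :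
    ∫⁻ x, (ENNReal.ofReal (gaussianLR ν v x) / ENNReal.ofReal (mixtureLR ν τ v w x)) ^ α *
      ENNReal.ofReal (mixtureLR ν τ v w x) ∂(isoGaussian ν 0) ≤
      ENNReal.ofReal (1 + 2 * α * (α - 1) * τ ^ 2 * (1 / ν ^ 2)) := by
  have h3 : 0 < 1 - τ := by linarith
  refine le_trans (le_of_eq (lintegral_congr fun x => ?_))
    (lintegral_comp_likelihoodRatio_le hν hα hvw (by fun_prop) (fun t ht => by positivity) hF)
  have hg := gaussianLR_pos ν v x
  have hm := mixtureLR_pos (ν := ν) hτ hτ1 v w x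
  rw [← ENNReal.ofReal_div_of_pos hm, ENNReal.ofReal_rpow_of_pos (div_pos hg hm),
    ← ENNReal.ofReal_mul' hm.le, mixtureLR_eq_mul]
  have hy : 0 < 1 - τ + τ * (gaussianLR ν w x / gaussianLR ν v x) := by
    have := div_pos (gaussianLR_pos ν w x) hg
    positivity
  set y := 1 - τ + τ * (gaussianLR ν w x / gaussianLR ν v x)
  congr 1
  rw [div_mul_cancel_right₀ hg.ne', Real.inv_rpow hy.le, ← Real.rpow_neg hy.le, ← mul_assoc,
    ← Real.rpow_add_one hy.ne', neg_add_eq_sub]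

end GaussianPair

/-! ### Poisson weights and insertion of one data point. -/

section PoissonSubsampling

variable {X : Type*} [DecidableEq X] {d : ℕ} {τ : ℝ}

lemma poissonWeight_nonneg (hτ : 0 ≤ τ) (hτ1 : τ ≤ 1) (D S : Finset X) :
    0 ≤ poissonWeight τ D S :=
  Finset.prod_nonneg fun x _ => by split_ifs <;> linarith

lemma poissonWeight_insert_left {D S : Finset X} {a : X} (ha : a ∉ D) (hS : S ⊆ D) :
    poissonWeight τ (insert a D) S = (1 - τ) * poissonWeight τ D S := by
  rw [poissonWeight, Finset.prod_insert ha, if_neg fun h => ha (hS h), poissonWeight]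

lemma poissonWeight_insert_insert {D : Finset X} (S : Finset X) {a : X} (ha : a ∉ D) :
    poissonWeight τ (insert a D) (insert a S) = τ * poissonWeight τ D S := by
  rw [poissonWeight, Finset.prod_insert ha, if_pos (Finset.mem_insert_self a S), poissonWeight]
  congr 1
  refine Finset.prod_congr rfl fun x hx => ?_
  have : x ≠ a := fun h => ha (h ▸ hx)
  simp [this]

lemma sum_poissonWeight (D : Finset X) : ∑ S ∈ D.powerset, poissonWeight τ D S = 1 := by
  induction D using Finset.induction_on with
  | empty => simp [poissonWeight]
  | insert a D ha ih =>
    rw [Finset.sum_powerset_insert ha,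
      Finset.sum_congr rfl fun S hS => poissonWeight_insert_left ha (Finset.mem_powerset.1 hS),
      Finset.sum_congr rfl fun S _ => poissonWeight_insert_insert S ha, ← Finset.mul_sum,
      ← Finset.mul_sum, ih]
    ring

lemma sum_ofReal_poissonWeight (hτ : 0 ≤ τ) (hτ1 : τ ≤ 1) (D : Finset X) :
    ∑ S ∈ D.powerset, ENNReal.ofReal (poissonWeight τ D S) = 1 := by
  rw [← ENNReal.ofReal_sum_of_nonneg fun S _ => poissonWeight_nonneg hτ hτ1 D S,
    sum_poissonWeight, ENNReal.ofReal_one]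

/-- Subsampling `insert a D` amounts to subsampling `D` and then adding `a` with
probability `τ`. -/
lemma poissonSubsampled_insert (hτ : 0 ≤ τ) (hτ1 : τ ≤ 1) (M : Mechanism X d) {D : Finset X}
    {a : X} (ha : a ∉ D) :
    poissonSubsampled τ M (insert a D) =
      ∑ S ∈ D.powerset, ENNReal.ofReal (poissonWeight τ D S) •
        (ENNReal.ofReal (1 - τ) • M S + ENNReal.ofReal τ • M (insert a S)) := by
  rw [poissonSubsampled, Finset.sum_powerset_insert ha, ← Finset.sum_add_distrib]
  refine Finset.sum_congr rfl fun S hS => ?_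
  rw [poissonWeight_insert_left ha (Finset.mem_powerset.1 hS), poissonWeight_insert_insert S ha,
    smul_add, smul_smul, smul_smul, ENNReal.ofReal_mul hτ, ENNReal.ofReal_mul (by linarith),
    mul_comm (ENNReal.ofReal τ), mul_comm (ENNReal.ofReal (1 - τ))]

lemma isProbabilityMeasure_poissonSubsampled (hτ : 0 ≤ τ) (hτ1 : τ ≤ 1) (M : Mechanism X d)
    [∀ S, IsProbabilityMeasure (M S)] (D : Finset X) :
    IsProbabilityMeasure (poissonSubsampled τ M D) := by
  refine ⟨?_⟩
  rw [poissonSubsampled, Measure.finsetSum_apply, ← sum_ofReal_poissonWeight hτ hτ1 D]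
  exact Finset.sum_congr rfl fun S _ => by simp

lemma norm_sub_le_of_l2Sensitivity_le {f : Finset X → EuclideanSpace ℝ (Fin d)}
    (hf : l2Sensitivity f ≤ 1) {D D' : Finset X} (h : Adjacent D D') : ‖f D - f D'‖ ≤ 1 := by
  rw [← ENNReal.ofReal_le_one]
  refine le_trans ?_ hf
  exact le_iSup_of_le D (le_iSup_of_le D' (le_iSup_of_le h le_rfl))

end PoissonSubsampling

end SubsampledRDP

/-! ### Assembly of the main theorem. -/

open SubsampledRDP in
theorem mainTheorem6 {X : Type*} [DecidableEq X] {d : ℕ}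
    (f : Finset X → EuclideanSpace ℝ (Fin d)) (hf : SubsampledRDP.l2Sensitivity f ≤ 1)
    (τ ν α : ℝ) (hτ : 0 < τ) (hτ1 : τ ≤ 1) (hν : 5 / 9 ≤ ν ^ 2) (hα : 1 < α)
    (hcond : α - 1 ≤ 2 / 3 * ν ^ 2 * Real.log (1 / (α * τ * (1 + ν ^ 2)))) :
    SubsampledRDP.IsRDP
      (SubsampledRDP.poissonSubsampled τ (SubsampledRDP.gaussianMechanism f ν))
      α (2 * τ ^ 2 * α / ν ^ 2) := by
  have hν2 : 0 < ν ^ 2 := by linarith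
  have hν0 : ν ≠ 0 := fun h => by simp [h] at hν2
  have hα0 : 0 < α := by linarith
  have hx : 0 < 1 / ν ^ 2 := by positivity
  have hx1 : 1 / ν ^ 2 ≤ 9 / 5 := by
    rw [div_le_iff₀ hν2]; linarith
  -- The exponentiated hypothesis in terms of `x = 1 / ν²`, using `(1 + ν²) / ν² = 1 + x`.
  have hcond' : α * τ * (1 + 1 / ν ^ 2) ≤
      1 / ν ^ 2 * Real.exp (-(3 / 2 * (α - 1) * (1 / ν ^ 2))) := by
    have h1 : 0 < α * τ * (1 + ν ^ 2) := by positivity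
    have h2 : α * τ * (1 + ν ^ 2) ≤ Real.exp (-(3 / 2 * (α - 1) * (1 / ν ^ 2))) := by
      rw [← Real.log_le_iff_le_exp h1]
      rw [one_div, Real.log_inv] at hcond
      have h3 : 3 / 2 * (α - 1) * (1 / ν ^ 2) ≤ -Real.log (α * τ * (1 + ν ^ 2)) := by
        rw [mul_one_div, div_le_iff₀ hν2]
        linarith
      linarith
    calc _ = 1 / ν ^ 2 * (α * τ * (1 + ν ^ 2)) := by field_simp; ring
      _ ≤ _ := by gcongr
  -- Strictness keeps `1 - τ` positive, as the mixture positivity lemma requires.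
  have hτlt : τ < 1 := by
    have := mul_rate_le hx hα hcond'
    nlinarith [mul_pos hτ hx]
  have hFA := dominatedByMoments_rpow hx hx1 hτ hα hcond'
  have hFB := dominatedByMoments_rpow_one_sub hx hx1 hτ hα hcond'
  have hc : 1 + (α - 1) * (2 * τ ^ 2 * α / ν ^ 2) =
      1 + 2 * α * (α - 1) * τ ^ 2 * (1 / ν ^ 2) := by ring
  have hgauss : ∀ D, poissonSubsampled τ (gaussianMechanism f ν) D =
      ∑ S ∈ D.powerset, ENNReal.ofReal (poissonWeight τ D S) •
        (isoGaussian ν 0).withDensity (fun x => ENNReal.ofReal (gaussianLR ν (f S) x)) := by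
    intro D
    simp_rw [← isoGaussian_eq_withDensity hν0]
    rfl
  have hmix : ∀ (D : Finset X) (a : X), a ∉ D →
      poissonSubsampled τ (gaussianMechanism f ν) (insert a D) =
      ∑ S ∈ D.powerset, ENNReal.ofReal (poissonWeight τ D S) • (isoGaussian ν 0).withDensity
        (fun x => ENNReal.ofReal (mixtureLR ν τ (f S) (f (insert a S)) x)) := by
    intro D a ha
    simp_rw [withDensity_mixtureLR hν0 hτ hτlt]
    exact poissonSubsampled_insert hτ.le hτ1 _ ha
  have hprob : ∀ S, IsProbabilityMeasure (gaussianMechanism f ν S) := fun S => by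
    unfold gaussianMechanism; infer_instance
  have hself : ∀ D, renyiDiv α (poissonSubsampled τ (gaussianMechanism f ν) D)
      (poissonSubsampled τ (gaussianMechanism f ν) D) ≤ ((2 * τ ^ 2 * α / ν ^ 2 : ℝ) : EReal) := by
    intro D
    have := isProbabilityMeasure_poissonSubsampled hτ.le hτ1 (gaussianMechanism f ν) D
    exact renyiDiv_self_le _ hα (by positivity)
  have hdist : ∀ (S : Finset X) (a : X), ‖f S - f (insert a S)‖ ≤ 1 := fun S a =>
    norm_sub_le_of_l2Sensitivity_le hf ⟨a, Or.inl rfl⟩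
  have hadd : ∀ (D : Finset X) (a : X), a ∉ D →
      renyiDiv α (poissonSubsampled τ (gaussianMechanism f ν) D)
        (poissonSubsampled τ (gaussianMechanism f ν) (insert a D)) ≤
        ((2 * τ ^ 2 * α / ν ^ 2 : ℝ) : EReal) := by
    intro D a ha
    rw [hmix D a ha, hgauss D]
    obtain ⟨h1, h2⟩ := renyi_moment_mixture_le (isoGaussian ν 0) D.powerset
      (fun S => ENNReal.ofReal (poissonWeight τ D S))
      (fun S x => ENNReal.ofReal (gaussianLR ν (f S) x))
      (fun S x => ENNReal.ofReal (mixtureLR ν τ (f S) (f (insert a S)) x))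
      (fun S => by fun_prop) (fun S => by fun_prop)
      (fun S x => (ENNReal.ofReal_pos.2 (mixtureLR_pos hτ hτlt _ _ x)).ne')
      (fun S x => ENNReal.ofReal_ne_top) (sum_ofReal_poissonWeight hτ.le hτ1 D) hα.le
      (fun S _ => renyi_moment_gaussian_mixture_le hν0 hα hτ hτlt (hdist S a) hFB)
    exact renyiDiv_le hα h1 (hc ▸ h2)
  have hremove : ∀ (D : Finset X) (a : X), a ∉ D →
      renyiDiv α (poissonSubsampled τ (gaussianMechanism f ν) (insert a D))
        (poissonSubsampled τ (gaussianMechanism f ν) D) ≤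
        ((2 * τ ^ 2 * α / ν ^ 2 : ℝ) : EReal) := by
    intro D a ha
    rw [hmix D a ha, hgauss D]
    obtain ⟨h1, h2⟩ := renyi_moment_mixture_le (isoGaussian ν 0) D.powerset
      (fun S => ENNReal.ofReal (poissonWeight τ D S))
      (fun S x => ENNReal.ofReal (mixtureLR ν τ (f S) (f (insert a S)) x))
      (fun S x => ENNReal.ofReal (gaussianLR ν (f S) x))
      (fun S => by fun_prop) (fun S => by fun_prop)
      (fun S x => (ENNReal.ofReal_pos.2 (gaussianLR_pos ν _ x)).ne')
      (fun S x => ENNReal.ofReal_ne_top) (sum_ofReal_poissonWeight hτ.le hτ1 D) hα.le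
      (fun S _ => renyi_moment_mixture_gaussian_le hν0 hα hτ hτlt (hdist S a) hFA)
    exact renyiDiv_le hα h1 (hc ▸ h2)
  -- Adjacency allows inserting a point already present or erasing an absent one; then the datasets
  -- coincide and `hself` applies.
  rintro D D' ⟨a, rfl | rfl⟩
  · by_cases ha : a ∈ D
    · rw [Finset.insert_eq_of_mem ha]; exact hself D
    · exact hadd D a ha
  · by_cases ha : a ∈ D
    · have := hremove (D.erase a) a (Finset.notMem_erase a D)
      rwa [Finset.insert_erase ha] at this
    · rw [Finset.erase_eq_of_notMem ha]; exact hself D
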